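/- Let $\Sigma$ be a finite alphabet with at least two symbols, one of them called $0$. A function $\varphi:\Sigma^*\to\Sigma^*$ is \emph{regular} if $|\varphi(u)|\le|\varphi(v)|$ whenever $|u|\le|v|$; $\mathbf{Reg}$ is the set of all regular functions, and the size $|\varphi|:\mathbb{N}\to\mathbb{N}$ of $\varphi\in\mathbf{Reg}$ is given by $|\varphi|(|u|)=|\varphi(u)|$. A \emph{representation} of a set $X$ by $\mathbf{Reg}$ (or by Cantor space $\Sigma^{\mathbb{N}}$, which is $\{0,1\}^{\mathbb N}$ for $\Sigma=\{0,1\}$) is a surjective partial function $\delta$ from $\mathbf{Reg}$ (from $\Sigma^{\mathbb N}$) onto $X$. An oracle Turing machine $M$ computes a partial function $F:\subseteq\mathbf{Reg}\to\mathbf{Reg}$ if, for every $\varphi\in\operatorname{dom}F$ and $u\in\Sigma^*$, $M$ with oracle $\varphi$ and input $u$ halts with output $F(\varphi)(u)$; it computes $F:\subseteq\mathbf{Reg}\to\Sigma^{\mathbb N}$ if, for every $\varphi\in\operatorname{dom}F$ and $n\in\mathbb{N}$, $M$ with oracle $\varphi$ and input $0^n$ halts and outputs the symbol $F(\varphi)(n)$.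 The second-order polynomials are generated from the positive integers and a variable $n$ by $P+Q$, $P\cdot Q$ and $L(P)$, where $L$ is a variable for a function $\mathbb{N}\to\mathbb{N}$. $M$ runs in polynomial time if there is a second-order polynomial $P$ such that, for all $\varphi\in\mathbf{Reg}$ and $u\in\Sigma^*$, $M$ with oracle $\varphi$ and input $u$ halts within $P(|\varphi|)(|u|)$ steps (an oracle query counts as one step). A map $f:(X,\delta_X)\to(Y,\delta_Y)$ is computable if some partial function $F$ that is computed by an oracle machine satisfies $\delta_Y(F(\varphi))=f(\delta_X(\varphi))$, both sides being defined, for all $\varphi\in\operatorname{dom}\delta_X$; it is polynomial-time computable if $F$ can be chosen to be computed by a machine that runs in polynomial time. The \emph{padding representation} $\pi:\subseteq\mathbf{Reg}\to\Sigma^{\mathbb N}$ has domain $\{\varphi\in\mathbf{Reg} : \operatorname{range}(|\varphi|)=\mathbb{N}\}$, and, for $i\in\mathbb{N}=\{0,1,2,\dots\}$, $\pi(\varphi)(i)$ is the last symbol of $\varphi(0^n)$, where $n=\min\{j\in\mathbb{N} : |\varphi(0^j)|=i+1\}$. \textbf{Proposition.} Let $\delta_X$ be a representation of a set $X$ by $\mathbf{Reg}$,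 let $\delta_Y$ be a representation of a set $Y$ by $\Sigma^{\mathbb N}$, and let $f:X\to Y$ be a function. Then $f:(X,\delta_X)\to(Y,\delta_Y)$ is computable if and only if $f:(X,\delta_X)\to(Y,\delta_Y\circ\pi)$ is polynomial-time computable. -/

import Mathlib

namespace TypeTwo

/-! ### Regular string functions, Cantor space, representations -/

/-- `φ : Σ* → Σ*` is regular if `|φ(u)| ≤ |φ(v)|` whenever `|u| ≤ |v|`. -/
def IsRegular {Sig : Type} (φ : List Sig → List Sig) : Prop :=
  ∀ u v : List Sig, u.length ≤ v.length → (φ u).length ≤ (φ v).length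

/-- The set of all (total) regular functions on strings over the alphabet `Sig`. -/
def Reg (Sig : Type) : Type := {φ : List Sig → List Sig // IsRegular φ}

instance (Sig : Type) : CoeFun (Reg Sig) (fun _ => List Sig → List Sig) := ⟨Subtype.val⟩

/-- The string `0ⁿ`. -/
abbrev zeros (Sig : Type) [Zero Sig] (n : ℕ) : List Sig := List.replicate n 0

/-- The size `|φ| : ℕ → ℕ` of a regular function, `|φ|(|u|) = |φ(u)|`. -/
def Reg.size {Sig : Type} [Zero Sig] (φ : Reg Sig) (n : ℕ) : ℕ := (φ (zeros Sig n)).length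

theorem Reg.size_length {Sig : Type} [Zero Sig] (φ : Reg Sig) (u : List Sig) :
    φ.size u.length = (φ u).length :=
  le_antisymm (φ.2 _ _ (by simp)) (φ.2 _ _ (by simp))

/-- Infinite sequences over `Sig`, indexed from `0`; for a two-letter alphabet this is `{0,1}^ℕ`. -/
abbrev Cantor (Sig : Type) : Type := ℕ → Sig

/-- A representation of the set `X` by elements of `N`: a surjective partial function. -/
structure Representation (N : Type*) (X : Type*) where
  /-- the partial function sending names to the points they name -/
  toPFun : N →. X
  surj : ∀ x : X, ∃ p : N, x ∈ toPFun p

/-- Composition `δ ∘ π` of representations. -/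
def Representation.comp {N M X : Type*} (δ : Representation N X) (π : Representation M N) :
    Representation M X where
  toPFun := δ.toPFun.comp π.toPFun
  surj x := by
    obtain ⟨p, hp⟩ := δ.surj x
    obtain ⟨q, hq⟩ := π.surj p
    exact ⟨q, Part.mem_bind hq hp⟩

/-! ### The padding representation -/

/-- The least `j` such that `φ(0ʲ)` has length `i + 1`. -/
noncomputable def padIndex {Sig : Type} [Zero Sig] (φ : Reg Sig) (i : ℕ) : ℕ :=
  sInf {j : ℕ | φ.size j = i + 1}

theorem padIndex_length {Sig : Type} [Zero Sig] (φ : Reg Sig)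
    (h : Set.range φ.size = Set.univ) (i : ℕ) :
    (φ (zeros Sig (padIndex φ i))).length = i + 1 :=
  Nat.sInf_mem (s := {j : ℕ | φ.size j = i + 1}) (h ▸ Set.mem_univ (i + 1) : i + 1 ∈ Set.range φ.size)

/-- The padding map, defined on the regular functions whose size has range `ℕ`. The symbol number
`i` (counted from `0`) of the sequence is the last symbol of `φ(0ⁿ)`, for the least `n` for which
`φ(0ⁿ)` has exactly `i + 1` symbols. -/
noncomputable def paddingFun (Sig : Type) [Zero Sig] : Reg Sig →. Cantor Sig := fun φ =>
  ⟨Set.range φ.size = Set.univ, fun h i =>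
    (φ (zeros Sig (padIndex φ i)))[i]'(by rw [padIndex_length φ h i]; exact i.lt_succ_self)⟩

/-- The padding representation `π` of Cantor space by regular functions. -/
noncomputable def padding (Sig : Type) [Zero Sig] : Representation (Reg Sig) (Cantor Sig) where
  toPFun := paddingFun Sig
  surj p := by
    let φ : Reg Sig := ⟨fun u => (List.range u.length).map p, fun u v h => by simpa using h⟩
    have hs : ∀ n, φ.size n = n := fun n => by simp [Reg.size, φ]
    refine ⟨φ, ⟨Set.eq_univ_of_forall fun n => ⟨n, hs n⟩, ?_⟩⟩
    funext i
    simp [paddingFun, φ]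

/-! ### Oracle Turing machines -/

/-- Contents of a tape cell: blank (`none`), a symbol of the alphabet, or one of finitely many
auxiliary symbols. -/
abbrev Cell (Sig Aux : Type) : Type := Option (Sig ⊕ Aux)

/-- The tapes of an oracle machine; the work tapes are indexed by `Work`. -/
inductive TapeName (Work : Type) : Type
  | input : TapeName Work
  | output : TapeName Work
  | query : TapeName Work
  | answer : TapeName Work
  | work (w : Work) : TapeName Work

/-- What a machine does in one step: halt; ask the oracle and go to a new state; or go to a new
state, write one symbol on every tape, and then move every head by at most one cell (`none`: the
head stays). -/
inductive Instr (Sig State Aux Work : Type) : Type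
  | halt : Instr Sig State Aux Work
  | ask (next : State) : Instr Sig State Aux Work
  | act (next : State) (write : TapeName Work → Cell Sig Aux)
      (move : TapeName Work → Option Turing.Dir) : Instr Sig State Aux Work

/-- Deterministic multi-tape oracle Turing machines with finitely many states, auxiliary tape
symbols and work tapes. The instruction depends on the state and on the scanned symbols. -/
structure OracleMachine (Sig : Type) where
  State : Type
  Aux : Type
  Work : Type
  finState : Finite State
  finAux : Finite Aux
  finWork : Finite Work
  start : State
  trans : State → (TapeName Work → Cell Sig Aux) → Instr Sig State Aux Work

/-- The longest initial string of alphabet symbols in a list of cells. -/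
def leadingWord {Sig Aux : Type} : List (Cell Sig Aux) → List Sig
  | some (Sum.inl a) :: l => a :: leadingWord l
  | _ => []

theorem leadingWord_append_blank {Sig Aux : Type} (l : List (Cell Sig Aux)) (n : ℕ) :
    leadingWord (l ++ List.replicate n default) = leadingWord l := by
  induction l with
  | nil => cases n <;> rfl
  | cons c l ih =>
    rcases c with _ | a | a
    · rfl
    · simp only [List.cons_append, leadingWord, ih]
    · rfl

/-- The string on a tape: the longest string of alphabet symbols that starts in the scanned cell and
extends to the right. -/
def tapeWord {Sig Aux : Type} (T : Turing.Tape (Cell Sig Aux)) : List Sig :=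
  T.right₀.liftOn leadingWord (by
    rintro a b ⟨n, rfl⟩
    exact (leadingWord_append_blank a n).symm)

/-- The tape holding only the string `u`, with the head on its first symbol. -/
def wordTape {Sig : Type} (Aux : Type) (u : List Sig) : Turing.Tape (Cell Sig Aux) :=
  Turing.Tape.mk₁ (u.map fun a => some (Sum.inl a))

namespace OracleMachine

variable {Sig : Type} (M : OracleMachine Sig)

/-- A configuration: the current state, and the tapes with their head positions. -/
structure Config where
  state : M.State
  tapes : TapeName M.Work → Turing.Tape (Cell Sig M.Aux)

/-- The initial configuration on input `u`: all tapes but the input tape are blank. -/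
def init (u : List Sig) : M.Config where
  state := M.start
  tapes
    | .input => wordTape M.Aux u
    | _ => wordTape M.Aux []

/-- The instruction that is executed in a configuration. -/
def instr (c : M.Config) : Instr Sig M.State M.Aux M.Work :=
  M.trans c.state fun t => (c.tapes t).head

/-- One step with oracle `φ`. Asking the oracle takes one step: the string `v` on the query tape is
erased, and the answer tape is made to hold `φ(v)`, scanned at its first symbol. A halted
configuration does not change. -/
def step (φ : List Sig → List Sig) (c : M.Config) : M.Config :=
  match M.instr c with
  | .halt => c
  | .ask q =>
    { state := q
      tapes := fun
        | .query => wordTape M.Aux []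
        | .answer => wordTape M.Aux (φ (tapeWord (c.tapes .query)))
        | t => c.tapes t }
  | .act q write move =>
    { state := q
      tapes := fun t =>
        match move t with
        | none => (c.tapes t).write (write t)
        | some d => ((c.tapes t).write (write t)).move d }

/-- The configuration after `n` steps with oracle `φ` on input `u`. -/
def run (φ : List Sig → List Sig) (u : List Sig) (n : ℕ) : M.Config :=
  (M.step φ)^[n] (M.init u)

/-- With oracle `φ` and input `u`, the machine halts within `n` steps. -/
def HaltsWithin (φ : List Sig → List Sig) (u : List Sig) (n : ℕ) : Prop :=
  M.instr (M.run φ u n) = .halt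

/-- With oracle `φ` and input `u`, the machine halts with the string `v` on its output tape. -/
def Outputs (φ : List Sig → List Sig) (u v : List Sig) : Prop :=
  ∃ n : ℕ, M.HaltsWithin φ u n ∧ tapeWord ((M.run φ u n).tapes .output) = v

/-- The machine computes the partial function `F` from regular functions to regular functions:
for `φ ∈ dom F`, it outputs `F(φ)(u)` on oracle `φ` and input `u`. -/
def ComputesReg (F : Reg Sig →. Reg Sig) : Prop :=
  ∀ φ ψ : Reg Sig, ψ ∈ F φ → ∀ u : List Sig, M.Outputs φ u (ψ u)

/-- The machine computes the partial function `F` from regular functions to Cantor space: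
for `φ ∈ dom F`, it outputs the symbol number `n` of `F(φ)` on oracle `φ` and input `0ⁿ`. -/
def ComputesCantor [Zero Sig] (F : Reg Sig →. Cantor Sig) : Prop :=
  ∀ (φ : Reg Sig) (p : Cantor Sig), p ∈ F φ → ∀ n : ℕ, M.Outputs φ (zeros Sig n) [p n]

end OracleMachine

/-! ### Second-order polynomials and polynomial time -/

/-- Second-order polynomials in the type-1 variable `L` and the type-0 variable `n`. -/
inductive SOPoly : Type
  | const (k : ℕ+) : SOPoly
  | var : SOPoly
  | add (P Q : SOPoly) : SOPoly
  | mul (P Q : SOPoly) : SOPoly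
  | app (P : SOPoly) : SOPoly

/-- The value `P(L)(n)`. -/
def SOPoly.eval (L : ℕ → ℕ) (n : ℕ) : SOPoly → ℕ
  | const k => k
  | var => n
  | add P Q => P.eval L n + Q.eval L n
  | mul P Q => P.eval L n * Q.eval L n
  | app P => L (P.eval L n)

/-- There is a second-order polynomial `P` such that for every regular oracle `φ` and every input
`u` the machine halts within `P(|φ|)(|u|)` steps. -/
def OracleMachine.RunsInPolyTime {Sig : Type} [Zero Sig] (M : OracleMachine Sig) : Prop :=
  ∃ P : SOPoly, ∀ (φ : Reg Sig) (u : List Sig), M.HaltsWithin φ u (P.eval φ.size u.length)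

/-! ### Computable maps between represented spaces -/

/-- `F` is a realizer of `f`: for every name `p` of a point `x`, `F(p)` is defined and is a name
of `f(x)`. -/
def IsRealizer {N N' X Y : Type*} (δX : Representation N X) (δY : Representation N' Y)
    (F : N →. N') (f : X → Y) : Prop :=
  ∀ (p : N) (x : X), x ∈ δX.toPFun p → ∃ q ∈ F p, f x ∈ δY.toPFun q

/-- `f` is computable from a space represented by regular functions to a space represented by
Cantor space: it has a computable realizer. -/
def IsComputableMap {Sig : Type} [Zero Sig] {X Y : Type*} (δX : Representation (Reg Sig) X)
    (δY : Representation (Cantor Sig) Y) (f : X → Y) : Prop :=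
  ∃ F : Reg Sig →. Cantor Sig, IsRealizer δX δY F f ∧
    ∃ M : OracleMachine Sig, M.ComputesCantor F

/-- `f` is polynomial-time computable between spaces represented by regular functions: it has a
realizer that is computed by a machine running in polynomial time. -/
def IsPolyTimeMap {Sig : Type} [Zero Sig] {X Y : Type*} (δX : Representation (Reg Sig) X)
    (δY : Representation (Reg Sig) Y) (f : X → Y) : Prop :=
  ∃ F : Reg Sig →. Reg Sig, IsRealizer δX δY F f ∧
    ∃ M : OracleMachine Sig, M.ComputesReg F ∧ M.RunsInPolyTime

end TypeTwo

/-! A padded name may postpone each new symbol until the input is long enough to pay for computing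
it. Given a machine `M` for a realizer into Cantor space, let `G φ u` be the list of symbols
obtained by simulating `M` on `0⁰, 0¹, 0², …` for `|u|` steps in total (`collectAt`). It depends
only on `|u|` and never shrinks, so `G φ` is regular. If all runs halt, every length is attained,
and a value of length `i + 1` ends with symbol number `i` (`collectAt_of_outputs`,
`exists_collectAt_length`). The step budget enforces the time bound even for oracles on which `M`
diverges (`loop_collect_halts`).

Conversely, let `M` compute a padded name `ψ`. Its size is monotone and onto, so the first `n` with
`|ψ(0ⁿ)| > i` is the first with `|ψ(0ⁿ)| = i + 1`, and unbounded search finds it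
(`loop_outputs_of_first_long`).

One simulating machine serves both directions. Its clock, never reset between runs, bounds by its
length how far from the heads the simulated tapes can be nonblank, and its zeros count the completed
runs, which is the length of the next input. The answer tape has no such bound, since oracle answers
can be long; asking for the empty string overwrites it with `φ []`, whose length is at most
`|φ|(|u|)` (`loop_restart`). -/

namespace TypeTwo

open Turing

/-! ### Tapes holding words -/

section Tapes

variable {Sig Aux : Type}

/-- The tape whose cells, apart from blanks, hold the reversal of `l` left of the head, and `r` from
the head onwards. -/
def splitTape (Aux : Type) (l r : List Sig) : Tape (Cell Sig Aux) :=
  Tape.mk' (ListBlank.mk (l.map fun a => some (Sum.inl a)))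
    (ListBlank.mk (r.map fun a => some (Sum.inl a)))

theorem wordTape_eq_splitTape (u : List Sig) : wordTape Aux u = splitTape Aux [] u := rfl

theorem splitTape_head_nil (l : List Sig) : (splitTape Aux l []).head = none := rfl

theorem splitTape_head_cons (l : List Sig) (a : Sig) (r : List Sig) :
    (splitTape Aux l (a :: r)).head = some (Sum.inl a) := rfl

theorem splitTape_move_right (l : List Sig) (a : Sig) (r : List Sig) :
    (splitTape Aux l (a :: r)).move Dir.right = splitTape Aux (a :: l) r := by
  simp [splitTape]

theorem splitTape_move_left (l : List Sig) (a : Sig) (r : List Sig) :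
    (splitTape Aux (a :: l) r).move Dir.left = splitTape Aux l (a :: r) := by
  rw [← splitTape_move_right, Tape.move_right_left]

theorem splitTape_nil_move_left_head (r : List Sig) :
    ((splitTape Aux [] r).move Dir.left).head = none := rfl

theorem splitTape_write (l : List Sig) (a : Sig) :
    (splitTape Aux l []).write (some (Sum.inl a)) = splitTape Aux l [a] := by
  simp [splitTape]

theorem wordTape_erase (a : Sig) (u : List Sig) :
    ((wordTape Aux (a :: u)).write none).move Dir.right = wordTape Aux u := by
  rw [wordTape_eq_splitTape, wordTape_eq_splitTape]
  simp only [splitTape, List.map_cons, Tape.write_mk', Tape.move_right_mk', ListBlank.head_cons,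
    ListBlank.tail_cons, ListBlank.tail_mk, List.tail_cons]
  congr 1
  exact ListBlank.ext fun i => by cases i <;> simp; rfl

theorem wordTape_prepend (a : Sig) (u : List Sig) :
    ((wordTape Aux u).move Dir.left).write (some (Sum.inl a)) = wordTape Aux (a :: u) := by
  rw [wordTape_eq_splitTape, wordTape_eq_splitTape]
  simp [splitTape]

/-- Writing and then moving is, up to a shift by one move, the move-and-write of `wordTape_prepend`;
the shift is harmless at the start because a blank tape is unchanged by a move. -/
theorem iterate_prepend (n : ℕ) (a : Sig) :
    ((fun T : Tape (Cell Sig Aux) => (T.write (some (Sum.inl a))).move Dir.left)^[n]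
      (wordTape Aux [])).move Dir.right = wordTape Aux (List.replicate n a) := by
  suffices h : (fun T : Tape (Cell Sig Aux) => (T.write (some (Sum.inl a))).move Dir.left)^[n]
      ((wordTape Aux []).move Dir.left) = (wordTape Aux (List.replicate n a)).move Dir.left by
    have h0 : (wordTape Aux ([] : List Sig)).move Dir.left = wordTape Aux [] := by
      simp only [wordTape_eq_splitTape, splitTape, Tape.move_left_mk']
      congr 1
      exact ListBlank.ext fun i => by cases i <;> simp
    rw [h0] at h
    rw [h, Tape.move_left_right]
  induction n with
  | zero => rfl
  | succ n ih =>
    rw [Function.iterate_succ_apply', ih, wordTape_prepend, List.replicate_succ]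

theorem tapeWord_of_head_inl {T : Tape (Cell Sig Aux)} {a : Sig}
    (h : T.head = some (Sum.inl a)) : tapeWord T = a :: tapeWord (T.move Dir.right) := by
  obtain ⟨L, R, rfl⟩ := T.exists_mk'
  induction R using ListBlank.induction_on with | _ R => ?_
  simp only [tapeWord, Tape.move_right_mk', Tape.mk'_right₀]
  cases R with
  | nil => cases h
  | cons c R =>
    obtain rfl : c = some (Sum.inl a) := h
    rfl

theorem tapeWord_of_head_ne_inl {T : Tape (Cell Sig Aux)}
    (h : ∀ a, T.head ≠ some (Sum.inl a)) : tapeWord T = [] := by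
  obtain ⟨L, R, rfl⟩ := T.exists_mk'
  induction R using ListBlank.induction_on with | _ R => ?_
  simp only [tapeWord, Tape.mk'_right₀]
  rcases R with _ | ⟨_ | a | a, R⟩
  · rfl
  · rfl
  · exact absurd rfl (h a)
  · rfl

theorem tapeWord_splitTape (l r : List Sig) : tapeWord (splitTape Aux l r) = r := by
  induction r generalizing l with
  | nil => exact tapeWord_of_head_ne_inl fun a => by simp [splitTape_head_nil]
  | cons a r ih => rw [tapeWord_of_head_inl (splitTape_head_cons l a r), splitTape_move_right, ih]

theorem tapeWord_wordTape (u : List Sig) : tapeWord (wordTape Aux u) = u :=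
  tapeWord_splitTape [] u

theorem wordTape_nth (u : List Sig) (n : ℕ) :
    (wordTape Aux u).nth n = (u[n]?).map Sum.inl := by
  rw [wordTape_eq_splitTape, splitTape, Tape.mk'_nth_nat, ListBlank.nth_mk]
  induction u generalizing n with
  | nil => rfl
  | cons a u ih => cases n with
    | zero => rfl
    | succ n => simpa using ih n

/-- All nonblank cells of the tape have positions between `a` and `b`, relative to the head. -/
def SupportedIn (a b : ℤ) (T : Tape (Cell Sig Aux)) : Prop :=
  ∀ i, T.nth i ≠ none → a ≤ i ∧ i ≤ b

theorem SupportedIn.mono {a b a' b' : ℤ} {T : Tape (Cell Sig Aux)} (h : SupportedIn a b T)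
    (ha : a' ≤ a) (hb : b ≤ b') : SupportedIn a' b' T := fun i hi =>
  ⟨ha.trans (h i hi).1, (h i hi).2.trans hb⟩

theorem SupportedIn.write {a b : ℤ} {T : Tape (Cell Sig Aux)} (h : SupportedIn a b T)
    (ha : a ≤ 0) (hb : 0 ≤ b) (x : Cell Sig Aux) : SupportedIn a b (T.write x) := by
  intro i hi
  rw [Tape.write_nth] at hi
  split_ifs at hi with h0
  · omega
  · exact h i hi

theorem SupportedIn.move_right {a b : ℤ} {T : Tape (Cell Sig Aux)} (h : SupportedIn a b T) :
    SupportedIn (a - 1) (b - 1) (T.move Dir.right) := by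
  intro i hi
  rw [Tape.move_right_nth] at hi
  have := h _ hi
  omega

theorem SupportedIn.move_left {a b : ℤ} {T : Tape (Cell Sig Aux)} (h : SupportedIn a b T) :
    SupportedIn (a + 1) (b + 1) (T.move Dir.left) := by
  intro i hi
  rw [Tape.move_left_nth] at hi
  have := h _ hi
  omega

theorem SupportedIn.iterate_move_right {a b : ℤ} {T : Tape (Cell Sig Aux)}
    (h : SupportedIn a b T) (n : ℕ) :
    SupportedIn (a - n) (b - n) ((Tape.move Dir.right)^[n] T) := by
  induction n with
  | zero => simpa using h
  | succ n ih =>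
    rw [Function.iterate_succ_apply']
    exact ih.move_right.mono (by push_cast; omega) (by push_cast; omega)

/-- Erase the scanned cell and move to the left. -/
def eraseLeft (T : Tape (Cell Sig Aux)) : Tape (Cell Sig Aux) := (T.write none).move Dir.left

/-- Once position `0` is blank, all nonblank cells lie strictly left of the head, so the shift keeps
the upper bound at `0` while the lower bound rises. Iteration squeezes the support to nothing. -/
theorem SupportedIn.eraseLeft {a : ℤ} {T : Tape (Cell Sig Aux)} (h : SupportedIn a 0 T) :
    SupportedIn (a + 1) 0 (eraseLeft T) := by
  intro i hi
  rw [TypeTwo.eraseLeft, Tape.move_left_nth, Tape.write_nth] at hi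
  split_ifs at hi with h0
  · exact absurd rfl hi
  · have := h _ hi
    omega

theorem SupportedIn.iterate_eraseLeft {a : ℤ} {T : Tape (Cell Sig Aux)}
    (h : SupportedIn a 0 T) (n : ℕ) : SupportedIn (a + n) 0 (TypeTwo.eraseLeft^[n] T) := by
  induction n with
  | zero => simpa using h
  | succ n ih =>
    rw [Function.iterate_succ_apply']
    exact ih.eraseLeft.mono (by push_cast; omega) le_rfl

theorem SupportedIn.eq_blank {a b : ℤ} {T : Tape (Cell Sig Aux)} (h : SupportedIn a b T)
    (hab : b < a) : T = wordTape Aux [] := by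
  have hT : ∀ i, T.nth i = none := fun i => by
    by_contra hi
    have := h i hi
    omega
  obtain ⟨x, L, R⟩ := T
  have hL : L = ListBlank.mk [] := ListBlank.ext fun n => (hT (-(n + 1 : ℕ))).trans (by simp; rfl)
  have hR : R = ListBlank.mk [] := ListBlank.ext fun n => (hT ((n + 1 : ℕ))).trans (by simp; rfl)
  have hx : x = none := hT 0
  subst hL hR hx
  rfl

theorem supportedIn_wordTape (u : List Sig) {a b : ℤ} (ha : a ≤ 0) (hb : (u.length : ℤ) ≤ b) :
    SupportedIn a b (wordTape Aux u) := by
  intro i hi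
  rcases i with n | n
  · rw [Int.ofNat_eq_natCast, wordTape_nth] at hi
    have : n < u.length := by
      by_contra hn
      simp [List.getElem?_eq_none (not_lt.1 hn)] at hi
    constructor
    · exact ha.trans (by simp)
    · simp only [Int.ofNat_eq_natCast]; omega
  · exact absurd (by change ListBlank.nth (ListBlank.mk []) n = none; simp; rfl) hi

/-- Move the head by at most one cell. -/
def moveOpt : Option Dir → Tape (Cell Sig Aux) → Tape (Cell Sig Aux)
  | none, T => T
  | some d, T => T.move d

theorem SupportedIn.moveOpt {a b : ℤ} {T : Tape (Cell Sig Aux)} (h : SupportedIn a b T)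
    (m : Option Dir) : SupportedIn (a - 1) (b + 1) (moveOpt m T) := by
  rcases m with _ | _ | _
  · exact h.mono (by omega) (by omega)
  · exact h.move_left.mono (by omega) (by omega)
  · exact h.move_right.mono (by omega) (by omega)

end Tapes

/-! ### Bounded reachability -/

namespace OracleMachine

variable {Sig : Type} (M : OracleMachine Sig) (φ : List Sig → List Sig)

/-- The configuration `c'` is reached from `c` in at most `B` steps. -/
def ReachesIn (B : ℕ) (c c' : M.Config) : Prop := ∃ n ≤ B, (M.step φ)^[n] c = c'

variable {M φ}

theorem ReachesIn.refl (c : M.Config) : M.ReachesIn φ 0 c c := ⟨0, le_rfl, rfl⟩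

theorem ReachesIn.mono {B B' : ℕ} {c c' : M.Config} (h : M.ReachesIn φ B c c') (hB : B ≤ B') :
    M.ReachesIn φ B' c c' := by
  obtain ⟨n, hn, e⟩ := h
  exact ⟨n, hn.trans hB, e⟩

theorem ReachesIn.trans {B B' : ℕ} {c c' c'' : M.Config} (h : M.ReachesIn φ B c c')
    (h' : M.ReachesIn φ B' c' c'') : M.ReachesIn φ (B + B') c c'' := by
  obtain ⟨n, hn, rfl⟩ := h
  obtain ⟨n', hn', rfl⟩ := h'
  exact ⟨n' + n, by omega, Function.iterate_add_apply _ _ _ _⟩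

theorem ReachesIn.single {c c' : M.Config} (h : M.step φ c = c') : M.ReachesIn φ 1 c c' :=
  ⟨1, le_rfl, h⟩

theorem ReachesIn.head {B : ℕ} {c c' c'' : M.Config} (h : M.step φ c = c')
    (h' : M.ReachesIn φ B c' c'') : M.ReachesIn φ (B + 1) c c'' :=
  ((ReachesIn.single h).trans h').mono (by omega)

theorem step_of_halt {c : M.Config} (h : M.instr c = .halt) : M.step φ c = c := by
  simp [step, h]

theorem run_add_of_haltsWithin {u : List Sig} {n : ℕ} (h : M.HaltsWithin φ u n) (k : ℕ) :
    M.run φ u (k + n) = M.run φ u n := by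
  rw [run, Function.iterate_add_apply]
  exact Function.iterate_fixed (step_of_halt h) k

/-- Lets the halting time met in a simulation replace the one hidden in `Outputs`. -/
theorem run_eq_of_haltsWithin {u : List Sig} {m n : ℕ} (hm : M.HaltsWithin φ u m)
    (hn : M.HaltsWithin φ u n) : M.run φ u m = M.run φ u n := by
  rw [← run_add_of_haltsWithin hm n, ← run_add_of_haltsWithin hn m, add_comm]

theorem ReachesIn.haltsWithin {u : List Sig} {B : ℕ} {c : M.Config}
    (h : M.ReachesIn φ B (M.init u) c) (hc : M.instr c = .halt) :
    M.HaltsWithin φ u B ∧ M.run φ u B = c := by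
  obtain ⟨n, hn, e⟩ := h
  have h1 : M.HaltsWithin φ u n := by rw [HaltsWithin, run, e, hc]
  have h2 : M.run φ u B = c := by
    obtain ⟨k, rfl⟩ := Nat.exists_eq_add_of_le' hn
    rw [run_add_of_haltsWithin h1, run, e]
  exact ⟨by rw [HaltsWithin, h2, hc], h2⟩

theorem ReachesIn.outputs {u v : List Sig} {B : ℕ} {c : M.Config}
    (h : M.ReachesIn φ B (M.init u) c) (hc : M.instr c = .halt)
    (hv : tapeWord (c.tapes .output) = v) : M.Outputs φ u v :=
  ⟨B, (h.haltsWithin hc).1, by rw [(h.haltsWithin hc).2, hv]⟩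

theorem step_act {c : M.Config} {q : M.State} {write : TapeName M.Work → Cell Sig M.Aux}
    {move : TapeName M.Work → Option Dir} (h : M.instr c = .act q write move) :
    M.step φ c = ⟨q, fun t => moveOpt (move t) ((c.tapes t).write (write t))⟩ := by
  simp only [step, h]
  congr 1
  funext t
  cases move t <;> rfl

end OracleMachine

/-! ### The machine that simulates another machine on the inputs `0⁰, 0¹, 0², …` -/

/-- States of the looping machine: `sim` and `query` simulate, `right` and `left` process the
result of a simulated run, and the other ones prepare the next run. -/
inductive LoopState (Q Sig : Type) : Type
  | sim (s : Q)
  | query (s : Q)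
  | right (a : Sig)
  | left
  | sweepRight
  | sweepLeft
  | sweepMore
  | load
  | flush
  | erase
  | done

instance {Q Sig : Type} [Finite Q] [Finite Sig] : Finite (LoopState Q Sig) := by
  let e : LoopState Q Sig → Q ⊕ Q ⊕ Sig ⊕ Fin 8 := fun
    | .sim s => .inl s
    | .query s => .inr (.inl s)
    | .right a => .inr (.inr (.inl a))
    | .left => .inr (.inr (.inr 0))
    | .sweepRight => .inr (.inr (.inr 1))
    | .sweepLeft => .inr (.inr (.inr 2))
    | .sweepMore => .inr (.inr (.inr 3))
    | .load => .inr (.inr (.inr 4))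
    | .flush => .inr (.inr (.inr 5))
    | .erase => .inr (.inr (.inr 6))
    | .done => .inr (.inr (.inr 7))
  exact Finite.of_injective e fun a b h => by cases a <;> cases b <;> simp_all [e]

/-- Work tapes of the looping machine: the input, output and work tapes of the simulated machine,
and a clock. -/
inductive LoopWork (W : Type) : Type
  | simInput
  | simOutput
  | clock
  | old (w : W)

instance {W : Type} [Finite W] : Finite (LoopWork W) := by
  let e : LoopWork W → W ⊕ Fin 3 := fun
    | .simInput => .inr 0
    | .simOutput => .inr 1
    | .clock => .inr 2
    | .old w => .inl w
  exact Finite.of_injective e fun a b h => by cases a <;> cases b <;> simp_all [e]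

/-- The tape of the looping machine that represents a tape of the simulated machine. -/
def simTape {W : Type} : TapeName W → TapeName (LoopWork W)
  | .input => .work .simInput
  | .output => .work .simOutput
  | .query => .query
  | .answer => .answer
  | .work w => .work (.old w)

/-- A function on the tapes of the looping machine, given by its values on the input tape, the
output tape, the clock and the simulated tapes. -/
def onTapes {W α : Type} (i o c : α) (s : TapeName W → α) : TapeName (LoopWork W) → α
  | .input => i
  | .output => o
  | .query => s .query
  | .answer => s .answer
  | .work .simInput => s .input
  | .work .simOutput => s .output
  | .work .clock => c
  | .work (.old w) => s (.work w)

theorem onTapes_simTape {W α : Type} (i o c : α) (s : TapeName W → α) (t : TapeName W) :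
    onTapes i o c s (simTape t) = s t := by
  cases t <;> rfl

/-- Apply a function to the component of the input tape. -/
def mapInput {W α : Type} (f : α → α) (s : TapeName W → α) : TapeName W → α
  | .input => f (s .input)
  | t => s t

/-- Apply a function to the component of the output tape. -/
def mapOutput {W α : Type} (f : α → α) (s : TapeName W → α) : TapeName W → α
  | .output => f (s .output)
  | t => s t

/-- Apply a function to the component of the answer tape. -/
def mapAnswer {W α : Type} (f : α → α) (s : TapeName W → α) : TapeName W → α
  | .answer => f (s .answer)
  | t => s t

/-- The alphabet symbol in a cell, and `0` if there is none. -/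
def cellSymbol {Sig Aux : Type} [Zero Sig] : Cell Sig Aux → Sig
  | some (Sum.inl a) => a
  | _ => 0

section Loop

variable {Sig : Type} [Zero Sig]

open Classical in
/-- The transition function of the looping machine. When `b` is true, every simulated step consumes
an input symbol, and the first symbol of the result of each simulated run is appended to the output.
When `b` is false, a simulated run is decisive if its result is longer than the input; then the
result's symbol at the position after the length of the input is the output. The clock records
every simulated step: `0` for the last step of a run, `one` for the other ones. -/
noncomputable def loopTrans (b : Bool) (one : Sig) (M : OracleMachine Sig)
    (q : LoopState M.State Sig) (r : TapeName (LoopWork M.Work) → Cell Sig M.Aux) :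
    Instr Sig (LoopState M.State Sig) M.Aux (LoopWork M.Work) :=
  let i := r .input
  let o := r .output
  let c := r (.work .clock)
  let s := fun t => r (simTape t)
  let R := some Dir.right
  let L := some Dir.left
  let B : Option Dir := if b then some Dir.right else none
  let stay : TapeName M.Work → Option Dir := fun _ => none
  match q with
  | .sim q =>
    if b = true ∧ i = none then .halt
    else match M.trans q s with
      | .halt => .act (.right (cellSymbol (s .output)))
          (onTapes i o (some (Sum.inl 0)) s) (onTapes B none R stay)
      -- An `ask` instruction cannot write, so the clock is marked first and the query takes a
      -- second step.
      | .ask q' => .act (.query q')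
          (onTapes i o (some (Sum.inl one)) s) (onTapes B none R stay)
      | .act q' w m => .act (.sim q')
          (onTapes i o (some (Sum.inl one)) w) (onTapes B none R m)
  | .query q => .ask (.sim q)
  | .right a =>
    if b then
      if o = none then
        .act .left (onTapes i (some (Sum.inl a)) c s) (onTapes none L none stay)
      else .act (.right a) r (onTapes none R none stay)
    else match s .output with
      | some (Sum.inl x) =>
        if i = none then
          .act .done (onTapes i (some (Sum.inl x)) c s) (onTapes none none none stay)
        else .act (.right a) r (onTapes R none none (mapOutput (fun _ => R) stay))
      | _ => .act .left r (onTapes L none none (mapOutput (fun _ => L) stay))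
  | .left =>
    if b then
      if o = none then .act .sweepRight r (onTapes none R L stay)
      else .act .left r (onTapes none L none stay)
    else
      -- The rewind is timed by the blank to the left of the input, because the simulated output
      -- tape may hold symbols to the left of its word.
      if i = none then
        .act .sweepRight r (onTapes R none L (mapOutput (fun _ => R) stay))
      else .act .left r (onTapes L none none (mapOutput (fun _ => L) stay))
  -- Four passes over the clock follow: one moves the simulated heads to the right end of the
  -- possible support, two erase leftwards (the support can be twice as wide as the clock), and one
  -- writes the next input.
  | .sweepRight =>
    if c = none then .act .sweepLeft r (onTapes none none R stay)
    else .act .sweepRight r (onTapes none none L fun _ => R)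
  | .sweepLeft =>
    if c = none then .act .sweepMore (onTapes i o c fun _ => none) (onTapes none none L fun _ => L)
    else .act .sweepLeft (onTapes i o c fun _ => none) (onTapes none none R fun _ => L)
  | .sweepMore =>
    if c = none then .act .load (onTapes i o c fun _ => none) (onTapes none none R fun _ => L)
    else .act .sweepMore (onTapes i o c fun _ => none) (onTapes none none L fun _ => L)
  | .load =>
    if c = none then .act .flush r (onTapes none none none (mapInput (fun _ => R) stay))
    else if c = some (Sum.inl 0) then
      .act .load (onTapes i o c (mapInput (fun _ => some (Sum.inl 0)) s))
        (onTapes none none R (mapInput (fun _ => L) stay))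
    else .act .load r (onTapes none none R stay)
  -- The query tape is blank by now, so the answer tape comes to hold `φ []`, whatever it held
  -- before and wherever its head was.
  | .flush => .ask .erase
  | .erase =>
    if s .answer = none then .act (.sim M.start) r (onTapes none none none stay)
    else .act .erase (onTapes i o c (mapAnswer (fun _ => none) s))
      (onTapes none none none (mapAnswer (fun _ => R) stay))
  | .done => .halt

/-- The machine that simulates `M` on the inputs `0⁰, 0¹, 0², …`. -/
noncomputable def loop [Finite Sig] (b : Bool) (one : Sig) (M : OracleMachine Sig) :
    OracleMachine Sig where
  State := LoopState M.State Sig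
  Aux := M.Aux
  Work := LoopWork M.Work
  finState := have := M.finState; inferInstance
  finAux := M.finAux
  finWork := have := M.finWork; inferInstance
  start := .sim M.start
  trans := loopTrans b one M

variable [Finite Sig] {b : Bool} {one : Sig} {M : OracleMachine Sig}

/-- A configuration of the looping machine, with given input tape, output tape, clock and simulated
tapes. -/
def loopCfg (b : Bool) (one : Sig) (M : OracleMachine Sig) (q : LoopState M.State Sig)
    (i o c : Tape (Cell Sig M.Aux)) (s : TapeName M.Work → Tape (Cell Sig M.Aux)) :
    (loop b one M).Config :=
  ⟨q, onTapes i o c s⟩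

variable {i o c : Tape (Cell Sig M.Aux)} {s : TapeName M.Work → Tape (Cell Sig M.Aux)}
  {φ : List Sig → List Sig}

theorem loop_init (u : List Sig) : (loop b one M).init u =
    loopCfg b one M (.sim M.start) (wordTape _ u) (wordTape _ []) (wordTape _ [])
      (M.init []).tapes := by
  simp only [OracleMachine.init, loopCfg]
  congr 1
  funext t
  rcases t with _ | _ | _ | _ | (_ | _ | _ | _) <;> rfl

theorem loopCfg_instr (q : LoopState M.State Sig) :
    (loop b one M).instr (loopCfg b one M q i o c s) =
      loopTrans b one M q (onTapes i.head o.head c.head fun t => (s t).head) := by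
  change loopTrans b one M q (fun t => (onTapes i o c s t).head) = _
  congr 1
  funext t
  rcases t with _ | _ | _ | _ | (_ | _ | _ | _) <;> rfl

theorem loopCfg_step_act {q q' : LoopState M.State Sig}
    {w : TapeName (LoopWork M.Work) → Cell Sig M.Aux}
    {mi mo mc : Option Dir} {ms : TapeName M.Work → Option Dir}
    (h : loopTrans b one M q (onTapes i.head o.head c.head fun t => (s t).head) =
      .act q' w (onTapes mi mo mc ms)) :
    (loop b one M).step φ (loopCfg b one M q i o c s) =
      loopCfg b one M q' (moveOpt mi (i.write (w .input))) (moveOpt mo (o.write (w .output)))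
        (moveOpt mc (c.write (w (.work .clock))))
        (fun t => moveOpt (ms t) ((s t).write (w (simTape t)))) := by
  rw [OracleMachine.step_act ((loopCfg_instr q).trans h), loopCfg]
  congr 1
  funext t
  rcases t with _ | _ | _ | _ | (_ | _ | _ | _) <;> rfl

/-- The effect of asking the oracle on the tapes of a machine. -/
def askTapes {W Aux : Type} (φ : List Sig → List Sig) (s : TapeName W → Tape (Cell Sig Aux)) :
    TapeName W → Tape (Cell Sig Aux)
  | .query => wordTape Aux []
  | .answer => wordTape Aux (φ (tapeWord (s .query)))
  | t => s t

theorem loopCfg_step_ask {q q' : LoopState M.State Sig}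
    (h : loopTrans b one M q (onTapes i.head o.head c.head fun t => (s t).head) = .ask q') :
    (loop b one M).step φ (loopCfg b one M q i o c s) =
      loopCfg b one M q' i o c (askTapes φ s) := by
  rw [OracleMachine.step, (loopCfg_instr q).trans h]
  simp only [loopCfg]
  congr 1
  funext t
  rcases t with _ | _ | _ | _ | (_ | _ | _ | _) <;> rfl

/-- The tape that holds the input of the looping machine moves if `b` is true. -/
def advance (b : Bool) (T : Tape (Cell Sig M.Aux)) : Tape (Cell Sig M.Aux) :=
  if b then T.move Dir.right else T

/-! ### Simulated steps -/

theorem loop_simStep {q : M.State} (cw : List Sig) (hi : b = true → i.head ≠ none)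
    (hq : M.instr ⟨q, s⟩ ≠ .halt) :
    (loop b one M).ReachesIn φ 2 (loopCfg b one M (.sim q) i o (splitTape _ cw []) s)
      (loopCfg b one M (.sim (M.step φ ⟨q, s⟩).state) (advance (M := M) b i) o
        (splitTape _ (one :: cw) []) (M.step φ ⟨q, s⟩).tapes) := by
  have hi' : ¬ (b = true ∧ i.head = none) := fun h => hi h.1 h.2
  have hin : M.instr ⟨q, s⟩ = M.trans q fun t => (s t).head := rfl
  cases hm : M.trans q fun t => (s t).head with
  | halt => exact absurd (hin.trans hm) hq
  | ask q' =>
    have h1 : M.step φ ⟨q, s⟩ = ⟨q', askTapes φ s⟩ := by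
      rw [OracleMachine.step, hin, hm]
      simp only
      congr 1
      funext t
      cases t <;> rfl
    rw [h1]
    refine .head (loopCfg_step_act (q' := .query q') (mi := if b then some Dir.right else none)
      (mo := none) (mc := some Dir.right) (ms := fun _ => none)
      (w := onTapes i.head o.head (some (Sum.inl one)) fun t => (s t).head) ?_) ?_
    · simp only [loopTrans, onTapes_simTape]
      simp only [onTapes, if_neg hi', hm]
    · refine .single ?_
      rw [loopCfg_step_ask (q' := .sim q') rfl]
      simp only [onTapes_simTape]
      simp only [onTapes, moveOpt, Tape.write_self, splitTape_write, splitTape_move_right]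
      cases b <;> rfl
  | act q' w m =>
    rw [OracleMachine.step_act (hin.trans hm)]
    refine .mono (.single ?_) one_le_two
    refine (loopCfg_step_act (q' := .sim q') (mi := if b then some Dir.right else none)
      (mo := none) (mc := some Dir.right) (ms := m)
      (w := onTapes i.head o.head (some (Sum.inl one)) w) ?_).trans ?_
    · simp only [loopTrans, onTapes_simTape]
      simp only [onTapes, if_neg hi', hm]
    · simp only [onTapes_simTape]
      simp only [onTapes, moveOpt, Tape.write_self, splitTape_write, splitTape_move_right]
      cases b <;> rfl

theorem loop_simHalt {q : M.State} (cw : List Sig) (hi : b = true → i.head ≠ none)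
    (hq : M.instr ⟨q, s⟩ = .halt) :
    (loop b one M).ReachesIn φ 1 (loopCfg b one M (.sim q) i o (splitTape _ cw []) s)
      (loopCfg b one M (.right (cellSymbol (s .output).head)) (advance (M := M) b i) o
        (splitTape _ (0 :: cw) []) s) := by
  have hi' : ¬ (b = true ∧ i.head = none) := fun h => hi h.1 h.2
  have hm : (M.trans q fun t => (s t).head) = .halt := hq
  refine .single ((loopCfg_step_act (q' := .right (cellSymbol (s .output).head))
    (mi := if b then some Dir.right else none)
    (mo := none) (mc := some Dir.right) (ms := fun _ => none)
    (w := onTapes i.head o.head (some (Sum.inl 0)) fun t => (s t).head) ?_).trans ?_)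
  · simp only [loopTrans, onTapes_simTape]
    simp only [onTapes, if_neg hi', hm]
  · simp only [onTapes_simTape]
    simp only [onTapes, moveOpt, Tape.write_self, splitTape_write, splitTape_move_right]
    cases b <;> rfl

end Loop

section Loop

variable {Sig : Type} [Zero Sig] [Finite Sig] {b : Bool} {one : Sig} {M : OracleMachine Sig}
  {i o c : Tape (Cell Sig M.Aux)} {s : TapeName M.Work → Tape (Cell Sig M.Aux)}
  {φ : List Sig → List Sig}

theorem loopCfg_step_move {q q' : LoopState M.State Sig}
    {mi mo mc : Option Dir} {ms : TapeName M.Work → Option Dir}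
    (h : loopTrans b one M q (onTapes i.head o.head c.head fun t => (s t).head) =
      .act q' (onTapes i.head o.head c.head fun t => (s t).head) (onTapes mi mo mc ms)) :
    (loop b one M).step φ (loopCfg b one M q i o c s) =
      loopCfg b one M q' (moveOpt mi i) (moveOpt mo o) (moveOpt mc c)
        (fun t => moveOpt (ms t) (s t)) := by
  rw [loopCfg_step_act h]
  simp only [onTapes_simTape]
  simp only [onTapes, Tape.write_self]

omit [Zero Sig] [Finite Sig] in
theorem moveOpt_mapOutput (d : Dir) :
    (fun t => moveOpt (mapOutput (fun _ => some d) (fun _ => none) t) (s t)) =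
      mapOutput (Tape.move d) s := by
  funext t
  cases t <;> rfl

theorem mapOutput_mapOutput {W α : Type} (f g : α → α) (s : TapeName W → α) :
    mapOutput f (mapOutput g s) = mapOutput (f ∘ g) s := by
  funext t
  cases t <;> rfl

theorem mapOutput_id {W α : Type} (s : TapeName W → α) : mapOutput id s = s := by
  funext t
  cases t <;> rfl

/-! ### Appending a symbol to the output -/

theorem loop_append_right (a : Sig) (l r : List Sig) :
    (loop true one M).ReachesIn φ (r.length + 1)
      (loopCfg true one M (.right a) i (splitTape _ l r) c s)
      (loopCfg true one M .left i ((splitTape _ (r.reverse ++ l) [a]).move Dir.left) c s) := by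
  induction r generalizing l with
  | nil =>
    refine .single ((loopCfg_step_act (q' := .left) (mi := none) (mo := some Dir.left)
      (mc := none) (ms := fun _ => none)
      (w := onTapes i.head (some (Sum.inl a)) c.head fun t => (s t).head) ?_).trans ?_)
    · simp only [loopTrans, onTapes_simTape]
      simp [onTapes, splitTape_head_nil]
    · simp only [onTapes_simTape]
      simp only [onTapes, moveOpt, Tape.write_self, splitTape_write, List.reverse_nil,
        List.nil_append]
  | cons x r ih =>
    refine .head (loopCfg_step_move (q' := .right a) (mi := none) (mo := some Dir.right)
      (mc := none) (ms := fun _ => none) ?_) ?_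
    · simp only [loopTrans]
      simp [onTapes, splitTape_head_cons]
    · simp only [moveOpt, splitTape_move_right]
      simpa using ih (x :: l)

theorem loop_append_left (l r : List Sig) :
    (loop true one M).ReachesIn φ (l.length + 1)
      (loopCfg true one M .left i ((splitTape _ l r).move Dir.left) c s)
      (loopCfg true one M .sweepRight i (splitTape _ [] (l.reverse ++ r)) (c.move Dir.left) s) := by
  induction l generalizing r with
  | nil =>
    refine .single ((loopCfg_step_move (q' := .sweepRight) (mi := none) (mo := some Dir.right)
      (mc := some Dir.left) (ms := fun _ => none) ?_).trans ?_)
    · simp only [loopTrans]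
      simp [onTapes, splitTape_nil_move_left_head]
    · simp [moveOpt]
  | cons x l ih =>
    refine .head (loopCfg_step_move (q' := .left) (mi := none) (mo := some Dir.left)
      (mc := none) (ms := fun _ => none) ?_) ?_
    · simp only [loopTrans]
      simp [onTapes, splitTape_move_left, splitTape_head_cons]
    · simp only [moveOpt, splitTape_move_left]
      simpa using ih (x :: r)

/-- One pass to the end and one back. With the head returned to the first symbol, the whole output
is readable whenever a later simulated step finds the input used up. -/
theorem loop_append (a : Sig) (w : List Sig) :
    (loop true one M).ReachesIn φ (2 * w.length + 2)
      (loopCfg true one M (.right a) i (wordTape _ w) c s)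
      (loopCfg true one M .sweepRight i (wordTape _ (w ++ [a])) (c.move Dir.left) s) := by
  have h := (loop_append_right (one := one) (i := i) (c := c) (s := s) (φ := φ) a [] w).trans
    (loop_append_left (w.reverse ++ []) [a])
  refine .mono (B := w.length + 1 + ((w.reverse ++ []).length + 1)) ?_ (by simp; omega)
  simpa [wordTape_eq_splitTape] using h

/-! ### Comparing a result with the input -/

/-- At the left blank both heads are one cell too far, and the last step corrects this; the net
effect undoes the comparison's moves. -/
theorem loop_compare_left (l r : List Sig) :
    (loop false one M).ReachesIn φ (l.length + 1)
      (loopCfg false one M .left ((splitTape _ l r).move Dir.left) o c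
        (mapOutput (Tape.move Dir.left) s))
      (loopCfg false one M .sweepRight (splitTape _ [] (l.reverse ++ r)) o (c.move Dir.left)
        (mapOutput (Tape.move Dir.left)^[l.length] s)) := by
  induction l generalizing r s with
  | nil =>
    refine .single ((loopCfg_step_move (q' := .sweepRight) (mi := some Dir.right) (mo := none)
      (mc := some Dir.left) (ms := mapOutput (fun _ => some Dir.right) fun _ => none) ?_).trans ?_)
    · simp only [loopTrans]
      simp [onTapes, splitTape_nil_move_left_head]
    · rw [moveOpt_mapOutput, mapOutput_mapOutput]
      have : Tape.move Dir.right ∘ Tape.move Dir.left =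
          (id : Tape (Cell Sig M.Aux) → Tape (Cell Sig M.Aux)) :=
        funext fun T => T.move_left_right
      rw [this]
      simp [moveOpt, mapOutput_id]
  | cons x l ih =>
    refine .head (loopCfg_step_move (q' := .left) (mi := some Dir.left) (mo := none)
      (mc := none) (ms := mapOutput (fun _ => some Dir.left) fun _ => none) ?_) ?_
    · simp only [loopTrans]
      simp [onTapes, splitTape_move_left, splitTape_head_cons]
    · rw [moveOpt_mapOutput]
      simp only [moveOpt, splitTape_move_left]
      have h := ih (x :: r) (s := mapOutput (Tape.move Dir.left) s)
      rw [mapOutput_mapOutput (_^[_])] at h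
      simpa using h

omit [Zero Sig] [Finite Sig] in
theorem mapOutput_move_right_left (n : ℕ) :
    mapOutput (Tape.move Dir.left)^[n + 1] (mapOutput (Tape.move Dir.right) s) =
      mapOutput (Tape.move Dir.left)^[n] s := by
  rw [mapOutput_mapOutput]
  congr 1
  funext T
  simp

theorem loop_compare_step (a : Sig) (l r : List Sig) {x y : Sig}
    (hx : (s .output).head = some (Sum.inl x)) :
    (loop false one M).step φ (loopCfg false one M (.right a) (splitTape _ l (y :: r)) o c s) =
      loopCfg false one M (.right a) (splitTape _ (y :: l) r) o c
        (mapOutput (Tape.move Dir.right) s) := by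
  refine (loopCfg_step_move (q' := .right a) (mi := some Dir.right) (mo := none)
    (mc := none) (ms := mapOutput (fun _ => some Dir.right) fun _ => none) ?_).trans ?_
  · simp only [loopTrans, onTapes_simTape]
    simp [onTapes, hx, splitTape_head_cons]
  · rw [moveOpt_mapOutput]
    simp only [moveOpt, splitTape_move_right]

theorem loop_compare_stop (a : Sig) (hs : ∀ x, (s .output).head ≠ some (Sum.inl x)) :
    (loop false one M).step φ (loopCfg false one M (.right a) i o c s) =
      loopCfg false one M .left (i.move Dir.left) o c (mapOutput (Tape.move Dir.left) s) := by
  refine (loopCfg_step_move (q' := .left) (mi := some Dir.left) (mo := none)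
    (mc := none) (ms := mapOutput (fun _ => some Dir.left) fun _ => none) ?_).trans ?_
  · simp only [loopTrans, onTapes_simTape]
    rcases h : (s .output).head with _ | x | x
    · simp
    · exact absurd h (hs x)
    · simp
  · rw [moveOpt_mapOutput]
    simp only [moveOpt]

theorem loop_compare_done (a : Sig) (l : List Sig) {x : Sig}
    (hx : (s .output).head = some (Sum.inl x)) :
    (loop false one M).step φ
        (loopCfg false one M (.right a) (splitTape _ l []) (wordTape _ []) c s) =
      loopCfg false one M .done (splitTape _ l []) (wordTape _ [x]) c s := by
  refine (loopCfg_step_act (q' := .done) (mi := none) (mo := none) (mc := none)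
    (ms := fun _ => none)
    (w := onTapes none (some (Sum.inl x)) c.head fun t => (s t).head) ?_).trans ?_
  · simp only [loopTrans, onTapes_simTape]
    simp [onTapes, hx, splitTape_head_nil]
  · simp only [onTapes_simTape]
    simp only [onTapes, moveOpt, Tape.write_self, wordTape_eq_splitTape, splitTape_write]
    congr 1

/-- The scan leaves the result no later than the input, and then rewinds. Restoring the simulated
output head matters because the support bounds used for erasing are relative to the heads. -/
theorem loop_compare_short (a : Sig) (l r : List Sig)
    (h : (tapeWord (s .output)).length ≤ r.length) :
    ∃ B, (loop false one M).ReachesIn φ B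
      (loopCfg false one M (.right a) (splitTape _ l r) o c s)
      (loopCfg false one M .sweepRight (splitTape _ [] (l.reverse ++ r)) o (c.move Dir.left)
        (mapOutput (Tape.move Dir.left)^[l.length] s)) := by
  induction r generalizing l s with
  | nil =>
    have hs : ∀ x, (s .output).head ≠ some (Sum.inl x) := fun x hx => by
      simp [tapeWord_of_head_inl hx] at h
    exact ⟨_, .head (loop_compare_stop a hs) (loop_compare_left l [])⟩
  | cons y r ih =>
    by_cases hs : ∃ x, (s .output).head = some (Sum.inl x)
    · obtain ⟨x, hx⟩ := hs
      rw [tapeWord_of_head_inl hx] at h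
      obtain ⟨B, hB⟩ := ih (s := mapOutput (Tape.move Dir.right) s) (y :: l)
        (by simpa [mapOutput] using h)
      rw [List.length_cons, mapOutput_move_right_left] at hB
      exact ⟨_, .head (loop_compare_step a l r hx) (by simpa using hB)⟩
    · push Not at hs
      exact ⟨_, .head (loop_compare_stop a hs) (loop_compare_left l _)⟩

/-- Each remaining input cell consumes one symbol of the result, so the symbol scanned at the end of
the input is the one at position `r.length`. -/
theorem loop_compare_long (a : Sig) (l r : List Sig)
    (h : r.length < (tapeWord (s .output)).length) :
    ∃ B i' s', (loop false one M).ReachesIn φ B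
      (loopCfg false one M (.right a) (splitTape _ l r) (wordTape _ []) c s)
      (loopCfg false one M .done i' (wordTape _ [(tapeWord (s .output))[r.length]]) c s') := by
  have hs : ∃ x, (s .output).head = some (Sum.inl x) := by
    by_contra hs
    push Not at hs
    simp [tapeWord_of_head_ne_inl hs] at h
  obtain ⟨x, hx⟩ := hs
  induction r generalizing l s x with
  | nil =>
    simp only [tapeWord_of_head_inl hx]
    exact ⟨_, _, _, .single (loop_compare_done a l hx)⟩
  | cons y r ih =>
    simp only [tapeWord_of_head_inl hx] at h ⊢
    have h' : r.length < (tapeWord (mapOutput (Tape.move Dir.right) s .output)).length := by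
      simpa [mapOutput] using h
    have hs : ∃ x, (mapOutput (Tape.move Dir.right) s .output).head = some (Sum.inl x) := by
      by_contra hs
      push Not at hs
      simp [tapeWord_of_head_ne_inl hs] at h'
    obtain ⟨x', hx'⟩ := hs
    obtain ⟨B, i', s', hB⟩ := ih (y :: l) h' x' hx'
    exact ⟨_, i', s', .head (loop_compare_step a l r hx) hB⟩

/-! ### Preparing the next run -/

theorem loopCfg_step_erase {q q' : LoopState M.State Sig} {mc : Option Dir}
    (h : loopTrans b one M q (onTapes i.head o.head c.head fun t => (s t).head) =
      .act q' (onTapes i.head o.head c.head fun _ => none)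
        (onTapes none none mc fun _ => some Dir.left)) :
    (loop b one M).step φ (loopCfg b one M q i o c s) =
      loopCfg b one M q' i o (moveOpt mc c) (fun t => eraseLeft (s t)) := by
  rw [loopCfg_step_act h]
  simp only [onTapes_simTape]
  simp only [onTapes, Tape.write_self]
  rfl

theorem loop_sweepRight (l r : List Sig) :
    (loop b one M).ReachesIn φ (l.length + 1)
      (loopCfg b one M .sweepRight i o ((splitTape _ l r).move Dir.left) s)
      (loopCfg b one M .sweepLeft i o (splitTape _ [] (l.reverse ++ r))
        fun t => (Tape.move Dir.right)^[l.length] (s t)) := by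
  induction l generalizing r s with
  | nil =>
    refine .single ((loopCfg_step_move (q' := .sweepLeft) (mi := none) (mo := none)
      (mc := some Dir.right) (ms := fun _ => none) ?_).trans ?_)
    · simp only [loopTrans]
      simp [onTapes, splitTape_nil_move_left_head]
    · simp [moveOpt]
  | cons x l ih =>
    refine .head (loopCfg_step_move (q' := .sweepRight) (mi := none) (mo := none)
      (mc := some Dir.left) (ms := fun _ => some Dir.right) ?_) ?_
    · simp only [loopTrans]
      simp [onTapes, splitTape_move_left, splitTape_head_cons]
    · simp only [moveOpt, splitTape_move_left]
      simpa using ih (x :: r) (s := fun t => (s t).move Dir.right)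

theorem loop_sweepLeft (l r : List Sig) :
    (loop b one M).ReachesIn φ (r.length + 1)
      (loopCfg b one M .sweepLeft i o (splitTape _ l r) s)
      (loopCfg b one M .sweepMore i o ((splitTape _ (r.reverse ++ l) []).move Dir.left)
        fun t => eraseLeft^[r.length + 1] (s t)) := by
  induction r generalizing l s with
  | nil =>
    refine .single ((loopCfg_step_erase (q' := .sweepMore) (mc := some Dir.left) ?_).trans ?_)
    · simp only [loopTrans]
      simp [onTapes, splitTape_head_nil]
    · simp [moveOpt]
  | cons x r ih =>
    refine .head (loopCfg_step_erase (q' := .sweepLeft) (mc := some Dir.right) ?_) ?_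
    · simp only [loopTrans]
      simp [onTapes, splitTape_head_cons]
    · simp only [moveOpt, splitTape_move_right]
      simpa using ih (x :: l) (s := fun t => eraseLeft (s t))

theorem loop_sweepMore (l r : List Sig) :
    (loop b one M).ReachesIn φ (l.length + 1)
      (loopCfg b one M .sweepMore i o ((splitTape _ l r).move Dir.left) s)
      (loopCfg b one M .load i o (splitTape _ [] (l.reverse ++ r))
        fun t => eraseLeft^[l.length + 1] (s t)) := by
  induction l generalizing r s with
  | nil =>
    refine .single ((loopCfg_step_erase (q' := .load) (mc := some Dir.right) ?_).trans ?_)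
    · simp only [loopTrans]
      simp [onTapes, splitTape_nil_move_left_head]
    · simp [moveOpt]
  | cons x l ih =>
    refine .head (loopCfg_step_erase (q' := .sweepMore) (mc := some Dir.left) ?_) ?_
    · simp only [loopTrans]
      simp [onTapes, splitTape_move_left, splitTape_head_cons]
    · simp only [moveOpt, splitTape_move_left]
      simpa using ih (x :: r) (s := fun t => eraseLeft (s t))

/-- Write a symbol and move to the left. -/
def writeLeft {Aux : Type} (a : Sig) (T : Tape (Cell Sig Aux)) : Tape (Cell Sig Aux) :=
  (T.write (some (Sum.inl a))).move Dir.left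

open Classical in
-- Only the number of zeros matters, so each zero on the clock is copied by writing `0` and moving
-- left; the final move right puts the head on the first symbol.
theorem loop_load (l r : List Sig) :
    (loop b one M).ReachesIn φ (r.length + 1)
      (loopCfg b one M .load i o (splitTape _ l r) s)
      (loopCfg b one M .flush i o (splitTape _ (r.reverse ++ l) [])
        (mapInput (fun T => ((writeLeft 0)^[r.count 0] T).move Dir.right) s)) := by
  induction r generalizing l s with
  | nil =>
    refine .single ((loopCfg_step_move (q' := .flush) (mi := none) (mo := none) (mc := none)
      (ms := mapInput (fun _ => some Dir.right) fun _ => none) ?_).trans ?_)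
    · simp only [loopTrans]
      simp [onTapes, splitTape_head_nil]
    · simp only [moveOpt, List.reverse_nil, List.nil_append, List.count_nil,
        Function.iterate_zero, id]
      congr 1
      funext t
      cases t <;> rfl
  | cons x r ih =>
    by_cases hx : x = 0
    · subst hx
      refine .head (loopCfg_step_act (q' := .load) (mi := none) (mo := none)
        (mc := some Dir.right) (ms := mapInput (fun _ => some Dir.left) fun _ => none)
        (w := onTapes i.head o.head (some (Sum.inl 0))
          (mapInput (fun _ => some (Sum.inl 0)) fun t => (s t).head)) ?_) ?_
      · simp only [loopTrans, onTapes_simTape]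
        simp [onTapes, splitTape_head_cons]
      · simp only [onTapes_simTape]
        simp only [onTapes, Tape.write_self]
        have h1 : (splitTape M.Aux l (0 :: r)).write (some (Sum.inl 0)) = splitTape _ l (0 :: r) :=
          Tape.write_self (splitTape M.Aux l (0 :: r))
        have h := ih (0 :: l) (s := mapInput (writeLeft 0) s)
        have e1 : (fun t => moveOpt (mapInput (fun _ => some Dir.left) (fun _ => none) t)
            ((s t).write (mapInput (fun _ => some (Sum.inl 0)) (fun t => (s t).head) t))) =
            mapInput (writeLeft 0) s := by
          funext t
          cases t <;> rfl
        have e2 : mapInput (fun T => ((writeLeft 0)^[r.count 0] T).move Dir.right)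
            (mapInput (writeLeft 0) s) =
            mapInput (fun T => ((writeLeft 0)^[(0 :: r).count 0] T).move Dir.right) s := by
          funext t
          cases t <;> simp [mapInput]
        rw [e1, ← e2, h1]
        simpa [moveOpt, splitTape_move_right] using h
    · refine .head (loopCfg_step_move (q' := .load) (mi := none) (mo := none)
        (mc := some Dir.right) (ms := fun _ => none) ?_) ?_
      · simp only [loopTrans]
        simp [onTapes, splitTape_head_cons, hx]
      · simp only [moveOpt, splitTape_move_right]
        simpa [List.count_cons_of_ne hx] using ih (x :: l)

theorem loop_erase (v : List Sig) (hv : s .answer = wordTape _ v) :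
    (loop b one M).ReachesIn φ (v.length + 1) (loopCfg b one M .erase i o c s)
      (loopCfg b one M (.sim M.start) i o c (mapAnswer (fun _ => wordTape _ []) s)) := by
  induction v generalizing s with
  | nil =>
    refine .single ((loopCfg_step_move (q' := .sim M.start) (mi := none) (mo := none)
      (mc := none) (ms := fun _ => none) ?_).trans ?_)
    · simp only [loopTrans, onTapes_simTape]
      simp [hv, wordTape_eq_splitTape, splitTape_head_nil]
    · simp only [moveOpt]
      congr 1
      funext t
      cases t <;> first | exact hv | rfl
  | cons x v ih =>
    refine .head (loopCfg_step_act (q' := .erase) (mi := none) (mo := none)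
      (mc := none) (ms := mapAnswer (fun _ => some Dir.right) fun _ => none)
      (w := onTapes i.head o.head c.head (mapAnswer (fun _ => none) fun t => (s t).head)) ?_) ?_
    · simp only [loopTrans, onTapes_simTape]
      simp [onTapes, hv, wordTape_eq_splitTape, splitTape_head_cons]
    · simp only [onTapes_simTape]
      simp only [onTapes, Tape.write_self]
      have e : (fun t => moveOpt (mapAnswer (fun _ => some Dir.right) (fun _ => none) t)
          ((s t).write (mapAnswer (fun _ => none) (fun t => (s t).head) t))) =
          mapAnswer (fun T => (T.write none).move Dir.right) s := by
        funext t
        cases t <;> rfl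
      have h := ih (s := mapAnswer (fun T => (T.write none).move Dir.right) s)
        (by simp only [mapAnswer, hv, wordTape_erase])
      rw [e, List.length_cons]
      have e' : mapAnswer (fun _ => wordTape M.Aux [])
          (mapAnswer (fun T => (T.write none).move Dir.right) s) =
          mapAnswer (fun _ => wordTape M.Aux []) s := by
        funext t
        cases t <;> rfl
      rw [e'] at h
      exact h

open Classical in
-- The cost is four passes of `cw.length + 1` steps, one query, and `(φ []).length + 1` steps to
-- erase its answer.
theorem loop_restart (cw : List Sig)
    (hs : ∀ t, t ≠ .answer → SupportedIn (-cw.length) cw.length (s t)) :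
    (loop b one M).ReachesIn φ (4 * cw.length + (φ []).length + 6)
      (loopCfg b one M .sweepRight i o ((splitTape _ cw []).move Dir.left) s)
      (loopCfg b one M (.sim M.start) i o (splitTape _ cw [])
        (M.init (zeros Sig (cw.count 0))).tapes) := by
  have h1 := loop_sweepRight (b := b) (one := one) (i := i) (o := o) (φ := φ) (s := s) cw []
  have h2 := h1.trans (loop_sweepLeft _ _)
  have h3 := h2.trans (loop_sweepMore _ _)
  have h4 := h3.trans (loop_load _ _)
  -- With `n = cw.length`, the right shift puts the support in `[-2n, 0]`; then `2(n + 1)` erasing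
  -- moves raise the lower bound to `2`, above the upper bound `0`.
  have hb : ∀ t, t ≠ .answer → eraseLeft^[cw.length + 1] (eraseLeft^[cw.length + 1]
      ((Tape.move Dir.right)^[cw.length] (s t))) = wordTape _ [] := by
    intro t ht
    have h := (((hs t ht).iterate_move_right cw.length).mono (b' := 0) le_rfl (by omega))
    refine ((h.iterate_eraseLeft (cw.length + 1)).iterate_eraseLeft (cw.length + 1)).eq_blank ?_
    push_cast
    omega
  simp only [List.append_nil, List.reverse_reverse, List.length_reverse, List.count_reverse]
    at h4
  have h5 := h4.trans (.single (loopCfg_step_ask (q' := .erase) rfl))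
  have h6 := h5.trans (loop_erase (φ []) (by
    simp only [askTapes, mapInput, hb .query (by simp), tapeWord_wordTape]))
  refine .mono (B := cw.length + 1 + (cw.length + 1) + (cw.length + 1) + (cw.length + 1) + 1 +
    ((φ []).length + 1)) ?_ (by omega)
  convert h6 using 2
  funext t
  cases t with
  | input =>
    simp only [mapAnswer, askTapes, mapInput, hb .input (by simp)]
    exact (iterate_prepend _ _).symm
  | output => exact (hb .output (by simp)).symm
  | work w => exact (hb (.work w) (by simp)).symm
  | query => rfl
  | answer => rfl

end Loop

/-! ### Growth of the tape supports along a run -/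

namespace OracleMachine

variable {Sig : Type} {M : OracleMachine Sig} {φ : List Sig → List Sig}

/-- A step writes only under a head and moves it by at most one cell, and a query blanks the query
tape. The answer tape must be excluded: one step can fill it arbitrarily far. -/
theorem supportedIn_step {n : ℕ} {c : M.Config}
    (h : ∀ t, t ≠ .answer → SupportedIn (-n) n (c.tapes t)) :
    ∀ t, t ≠ .answer → SupportedIn (-(n + 1 : ℕ)) (n + 1 : ℕ) ((M.step φ c).tapes t) := by
  intro t ht
  have hm : SupportedIn (-(n + 1 : ℕ)) (n + 1 : ℕ) (c.tapes t) :=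
    (h t ht).mono (by push_cast; omega) (by push_cast; omega)
  cases hi : M.instr c with
  | halt => rwa [step_of_halt hi]
  | ask q =>
    simp only [step, hi]
    cases t with
    | query => exact supportedIn_wordTape [] (by omega) (by simp; omega)
    | answer => exact absurd rfl ht
    | _ => exact hm
  | act q w m =>
    rw [step_act hi]
    exact (((h t ht).write (by omega) (by omega) _).moveOpt _).mono (by push_cast; omega)
      (by push_cast; omega)

theorem supportedIn_init [Zero Sig] {n k : ℕ} (h : n ≤ k) (t : TapeName M.Work) :
    SupportedIn (-k) k ((M.init (zeros Sig n)).tapes t) := by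
  cases t with
  | input => exact supportedIn_wordTape _ (by omega) (by simpa using h)
  | _ => exact supportedIn_wordTape [] (by omega) (by simp)

end OracleMachine

section Loop

variable {Sig : Type} [Zero Sig] [Finite Sig] {one : Sig} {M : OracleMachine Sig}
  {φ : List Sig → List Sig}

/-! ### Collecting the results of simulated runs -/

open Classical in
/-- One step in the simulation of `M` on the inputs `0⁰, 0¹, 0², …`, together with the list of the
symbols that have been computed so far. -/
noncomputable def collect (M : OracleMachine Sig) (φ : List Sig → List Sig)
    (x : M.Config × List Sig) : M.Config × List Sig :=
  if M.instr x.1 = .halt then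
    (M.init (zeros Sig (x.2.length + 1)), x.2 ++ [cellSymbol (x.1.tapes .output).head])
  else (M.step φ x.1, x.2)

/-- The result of a given number of steps of `collect`. -/
noncomputable def collectAt (M : OracleMachine Sig) (φ : List Sig → List Sig) (n : ℕ) :
    M.Config × List Sig :=
  (collect M φ)^[n] (M.init [], [])

omit [Finite Sig] in
theorem collectAt_succ (n : ℕ) : collectAt M φ (n + 1) = collect M φ (collectAt M φ n) :=
  Function.iterate_succ_apply' _ _ _

omit [Finite Sig] in
-- This is the regularity of the collected output, valid also when some run diverges and the list
-- stops growing.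
theorem collectAt_length_mono : Monotone fun n => (collectAt M φ n).2.length := by
  refine monotone_nat_of_le_succ fun n => ?_
  rw [collectAt_succ, collect]
  split_ifs <;> simp

open Classical in
-- The costliest step ends a run: `1` to detect the halt, `2|w| + 2` to append, `4(n + 1) + |φ []| +
-- 6` to restart. As `|w| ≤ n < |u|`, the factor in the bound covers this generously.
theorem loop_collect (h1 : one ≠ 0) (u : List Sig) (n : ℕ) (hn : n ≤ u.length) :
    ∃ cw : List Sig, cw.length = n ∧ cw.count 0 = (collectAt M φ n).2.length ∧
      (∀ t, t ≠ .answer → SupportedIn (-n) n ((collectAt M φ n).1.tapes t)) ∧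
      (loop true one M).ReachesIn φ (n * (10 * u.length + (φ []).length + 20))
        ((loop true one M).init u)
        (loopCfg true one M (.sim (collectAt M φ n).1.state)
          ((Tape.move Dir.right)^[n] (wordTape _ u)) (wordTape _ (collectAt M φ n).2)
          (splitTape _ cw []) (collectAt M φ n).1.tapes) := by
  induction n with
  | zero =>
    refine ⟨[], rfl, rfl, fun t _ => OracleMachine.supportedIn_init (n := 0) le_rfl t, ?_⟩
    rw [loop_init, zero_mul]
    exact .refl _
  | succ n ih =>
    obtain ⟨cw, hl, hc, hs, hr⟩ := ih (by omega)
    have hw : (collectAt M φ n).2.length ≤ n := by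
      rw [← hc, ← hl]
      exact List.count_le_length
    have hi : true = true → ((Tape.move Dir.right)^[n] (wordTape M.Aux u)).head ≠ none := by
      intro _
      rw [Tape.move_right_n_head, wordTape_nth, List.getElem?_eq_getElem (by omega)]
      simp
    rw [collectAt_succ, Function.iterate_succ_apply']
    generalize collectAt M φ n = x at *
    obtain ⟨c, w⟩ := x
    change w.length ≤ n at hw
    by_cases hh : M.instr c = .halt
    · have e : collect M φ (c, w) = (M.init (zeros Sig (w.length + 1)),
          w ++ [cellSymbol (c.tapes .output).head]) := by
        simp [collect, hh]
      rw [e]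
      have hc' : (0 :: cw).count 0 = w.length + 1 := by simpa using hc
      refine ⟨0 :: cw, by simpa using hl, by simpa using hc, fun t _ =>
        OracleMachine.supportedIn_init (by omega) t, ?_⟩
      have h := ((hr.trans (loop_simHalt cw hi hh)).trans (loop_append _ w)).trans
        (loop_restart (0 :: cw) (by
          intro t ht
          rw [List.length_cons, hl]
          exact (hs t ht).mono (by push_cast; omega) (by push_cast; omega)))
      rw [hc'] at h
      refine h.mono ?_
      simp only [List.length_cons, hl, add_mul]
      omega
    · have e : collect M φ (c, w) = (M.step φ c, w) := by simp [collect, hh]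
      rw [e]
      refine ⟨one :: cw, by simpa using hl, by simpa [List.count_cons_of_ne h1] using hc,
        OracleMachine.supportedIn_step hs, ?_⟩
      refine (hr.trans (loop_simStep cw hi hh)).mono ?_
      rw [add_mul]
      omega

theorem loop_collect_halts (h1 : one ≠ 0) (u : List Sig) {B : ℕ}
    (hB : u.length * (10 * u.length + (φ []).length + 20) ≤ B) :
    (loop true one M).HaltsWithin φ u B ∧
      (loop true one M).Outputs φ u (collectAt M φ u.length).2 := by
  obtain ⟨cw, -, -, -, h⟩ := loop_collect (M := M) (φ := φ) h1 u u.length le_rfl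
  have hh : (loop true one M).instr (loopCfg true one M (.sim (collectAt M φ u.length).1.state)
      ((Tape.move Dir.right)^[u.length] (wordTape _ u)) (wordTape _ (collectAt M φ u.length).2)
      (splitTape _ cw []) (collectAt M φ u.length).1.tapes) = .halt := by
    rw [loopCfg_instr]
    simp [loopTrans, onTapes, wordTape_nth]
    rfl
  exact ⟨((h.mono hB).haltsWithin hh).1, h.outputs hh (tapeWord_wordTape _)⟩

omit [Finite Sig] in
-- Soundness of every partial list: a completed run on `0ᵏ` contributes exactly `p k`.
theorem collectAt_of_outputs {p : ℕ → Sig} (hp : ∀ n, M.Outputs φ (zeros Sig n) [p n]) (j : ℕ) :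
    ∃ k t, collectAt M φ j = (M.run φ (zeros Sig k) t, (List.range k).map p) := by
  induction j with
  | zero => exact ⟨0, 0, rfl⟩
  | succ j ih =>
    obtain ⟨k, t, e⟩ := ih
    rw [collectAt_succ, e, collect]
    split_ifs with hh
    · refine ⟨k + 1, 0, ?_⟩
      obtain ⟨m, hm, hv⟩ := hp k
      rw [← OracleMachine.run_eq_of_haltsWithin (m := t) hh hm] at hv
      have hx : cellSymbol ((M.run φ (zeros Sig k) t).tapes .output).head = p k := by
        by_cases hx : ∃ x, ((M.run φ (zeros Sig k) t).tapes .output).head = some (Sum.inl x)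
        · obtain ⟨x, hx⟩ := hx
          rw [tapeWord_of_head_inl hx] at hv
          rw [hx]
          exact (List.cons.inj hv).1
        · push Not at hx
          simp [tapeWord_of_head_ne_inl hx] at hv
      rw [hx]
      simp [List.range_succ, OracleMachine.run]
    · exact ⟨k, t + 1, by rw [OracleMachine.run, OracleMachine.run, Function.iterate_succ_apply']⟩

omit [Finite Sig] in
-- Progress: before the least halting time of run `k` only ordinary steps are taken, and one step
-- after it run `k + 1` begins.
theorem exists_collectAt_length {p : ℕ → Sig} (hp : ∀ n, M.Outputs φ (zeros Sig n) [p n])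
    (k : ℕ) : ∃ j, collectAt M φ j = (M.init (zeros Sig k), (List.range k).map p) := by
  induction k with
  | zero => exact ⟨0, rfl⟩
  | succ k ih =>
    obtain ⟨j, e⟩ := ih
    classical
    have hex : ∃ n, M.HaltsWithin φ (zeros Sig k) n := (hp k).imp fun n hn => hn.1
    have hrun : ∀ t ≤ Nat.find hex,
        collectAt M φ (j + t) = (M.run φ (zeros Sig k) t, (List.range k).map p) := by
      intro t
      induction t with
      | zero => exact fun _ => e
      | succ t ih =>
        intro ht
        have hh : ¬ M.instr (M.run φ (zeros Sig k) t) = .halt := Nat.find_min hex ht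
        rw [← add_assoc, collectAt_succ, ih (by omega), collect, if_neg hh, OracleMachine.run,
          OracleMachine.run, Function.iterate_succ_apply']
    have hh : M.instr (M.run φ (zeros Sig k) (Nat.find hex)) = .halt := Nat.find_spec hex
    have e1 : collectAt M φ (j + Nat.find hex + 1) = (M.init (zeros Sig (k + 1)),
        (List.range k).map p ++ [cellSymbol ((M.run φ (zeros Sig k) (Nat.find hex)).tapes
          .output).head]) := by
      rw [collectAt_succ, hrun _ le_rfl, collect, if_pos hh]
      simp
    -- Soundness already determines the list up to its length, so the new symbol need not be
    -- computed again.
    obtain ⟨k', t, e2⟩ := collectAt_of_outputs hp (j + Nat.find hex + 1)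
    refine ⟨_, e1.trans ?_⟩
    rw [e1] at e2
    have e3 : _ ++ _ = _ := (Prod.ext_iff.1 e2).2
    have : k' = k + 1 := by simpa using (congrArg List.length e3).symm
    rw [e3, this]

/-! ### Searching for a long result -/

open Classical in
theorem loop_simRun (u : List Sig) (n : ℕ) (cw : List Sig) (t : ℕ) (h1 : one ≠ 0)
    (hn : cw.count 0 = n) {o : Tape (Cell Sig M.Aux)} :
    ∃ B, ∃ cw' : List Sig, cw'.count 0 = n ∧
      (∀ s, s ≠ .answer → SupportedIn (-cw'.length) cw'.length
        ((M.run φ (zeros Sig n) t).tapes s)) ∧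
      (loop false one M).ReachesIn φ B
        (loopCfg false one M (.sim M.start) (wordTape _ u) o (splitTape _ cw [])
          (M.init (zeros Sig n)).tapes)
        (loopCfg false one M (.sim (M.run φ (zeros Sig n) t).state) (wordTape _ u) o
          (splitTape _ cw' []) (M.run φ (zeros Sig n) t).tapes) := by
  induction t with
  | zero =>
    exact ⟨0, cw, hn, fun s _ => OracleMachine.supportedIn_init (hn ▸ List.count_le_length) s,
      .refl _⟩
  | succ t ih =>
    obtain ⟨B, cw', hc, hs, hr⟩ := ih
    have e : M.run φ (zeros Sig n) (t + 1) = M.step φ (M.run φ (zeros Sig n) t) :=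
      Function.iterate_succ_apply' _ _ _
    rw [e]
    by_cases hh : M.instr (M.run φ (zeros Sig n) t) = .halt
    · rw [OracleMachine.step_of_halt hh]
      exact ⟨B, cw', hc, hs, hr⟩
    · refine ⟨_, one :: cw', by simpa [List.count_cons_of_ne h1] using hc,
        OracleMachine.supportedIn_step hs, hr.trans (loop_simStep cw' (by simp) hh)⟩

open Classical in
theorem loop_run_short (h1 : one ≠ 0) (u : List Sig) {n : ℕ} {v : List Sig}
    (cw : List Sig) (hn : cw.count 0 = n) (hv : M.Outputs φ (zeros Sig n) v)
    (hl : v.length ≤ u.length) {o : Tape (Cell Sig M.Aux)} :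
    ∃ B, ∃ cw' : List Sig, cw'.count 0 = n + 1 ∧ (loop false one M).ReachesIn φ B
        (loopCfg false one M (.sim M.start) (wordTape _ u) o (splitTape _ cw [])
          (M.init (zeros Sig n)).tapes)
        (loopCfg false one M (.sim M.start) (wordTape _ u) o (splitTape _ cw' [])
          (M.init (zeros Sig (n + 1))).tapes) := by
  obtain ⟨t, hh, rfl⟩ := hv
  obtain ⟨B, cw', hc, hs, hr⟩ := loop_simRun (φ := φ) (o := o) u n cw t h1 hn
  obtain ⟨B', hB'⟩ := loop_compare_short (one := one) (φ := φ) (o := o)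
    (c := splitTape _ (0 :: cw') []) (s := (M.run φ (zeros Sig n) t).tapes)
    (cellSymbol ((M.run φ (zeros Sig n) t).tapes .output).head) [] u hl
  have h2 := (hr.trans (loop_simHalt cw' (by simp) hh)).trans hB'
  rw [List.length_nil, Function.iterate_zero, mapOutput_id] at h2
  have h3 := h2.trans (loop_restart (0 :: cw') (by
    intro s hs'
    rw [List.length_cons]
    exact (hs s hs').mono (by push_cast; omega) (by push_cast; omega)))
  have hc' : (0 :: cw').count 0 = n + 1 := by simpa using hc
  rw [hc'] at h3
  exact ⟨_, 0 :: cw', hc', h3⟩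

open Classical in
theorem loop_run_long (h1 : one ≠ 0) (u : List Sig) {n : ℕ} {v : List Sig}
    (cw : List Sig) (hn : cw.count 0 = n) (hv : M.Outputs φ (zeros Sig n) v)
    (hl : u.length < v.length) :
    ∃ B i' c' s', (loop false one M).ReachesIn φ B
        (loopCfg false one M (.sim M.start) (wordTape _ u) (wordTape _ []) (splitTape _ cw [])
          (M.init (zeros Sig n)).tapes)
        (loopCfg false one M .done i' (wordTape _ [v[u.length]]) c' s') := by
  obtain ⟨t, hh, rfl⟩ := hv
  obtain ⟨B, cw', hc, hs, hr⟩ := loop_simRun (φ := φ) (o := wordTape _ []) u n cw t h1 hn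
  obtain ⟨B', i', s', hB'⟩ := loop_compare_long (one := one) (φ := φ)
    (c := splitTape _ (0 :: cw') []) (s := (M.run φ (zeros Sig n) t).tapes)
    (cellSymbol ((M.run φ (zeros Sig n) t).tapes .output).head) [] u hl
  exact ⟨_, i', _, s', (hr.trans (loop_simHalt cw' (by simp) hh)).trans hB'⟩

theorem loop_outputs_of_first_long (h1 : one ≠ 0) (u : List Sig) {v : ℕ → List Sig} {m : ℕ}
    (hv : ∀ n, M.Outputs φ (zeros Sig n) (v n)) (hm : ∀ n < m, (v n).length ≤ u.length)
    (hl : u.length < (v m).length) :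
    (loop false one M).Outputs φ u [(v m)[u.length]] := by
  classical
  have h : ∀ n ≤ m, ∃ B, ∃ cw : List Sig, cw.count 0 = n ∧ (loop false one M).ReachesIn φ B
      ((loop false one M).init u) (loopCfg false one M (.sim M.start) (wordTape _ u)
        (wordTape _ []) (splitTape _ cw []) (M.init (zeros Sig n)).tapes) := by
    intro n
    induction n with
    | zero =>
      intro _
      refine ⟨0, [], rfl, ?_⟩
      rw [loop_init]
      exact .refl _
    | succ n ih =>
      intro hn
      obtain ⟨B, cw, hc, hr⟩ := ih (by omega)
      obtain ⟨B', cw', hc', hr'⟩ := loop_run_short h1 u cw hc (hv n) (hm n hn)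
      exact ⟨_, cw', hc', hr.trans hr'⟩
  obtain ⟨B, cw, hc, hr⟩ := h m le_rfl
  obtain ⟨B', i', c', s', hr'⟩ := loop_run_long h1 u cw hc (hv m) hl
  exact (hr.trans hr').outputs rfl (tapeWord_wordTape _)

end Loop

/-! ### The padding representation and the two implications -/

section Main

variable {Sig : Type} [Zero Sig]

theorem Reg.size_mono (φ : Reg Sig) : Monotone φ.size := fun m n h => φ.2 _ _ (by simpa using h)

variable [Finite Sig] [Nontrivial Sig] {X Y : Type*} {δX : Representation (Reg Sig) X}
  {δY : Representation (Cantor Sig) Y} {f : X → Y}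

theorem isPolyTimeMap_of_isComputableMap (h : IsComputableMap δX δY f) :
    IsPolyTimeMap δX (δY.comp (padding Sig)) f := by
  obtain ⟨F, hF, M, hM⟩ := h
  obtain ⟨one, h1⟩ := exists_ne (0 : Sig)
  let G : Reg Sig → Reg Sig := fun φ => ⟨fun u => (collectAt M φ u.length).2, fun u v huv =>
    collectAt_length_mono huv⟩
  refine ⟨fun φ => Part.some (G φ), ?_, loop true one M, ?_, ?_⟩
  · intro φ x hx
    obtain ⟨p, hp, hy⟩ := hF φ x hx
    refine ⟨G φ, Part.mem_some _, Part.mem_bind ?_ hy⟩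
    have hout := hM φ p hp
    have hr : Set.range (G φ).size = Set.univ := by
      refine Set.eq_univ_of_forall fun k => ?_
      obtain ⟨j, hj⟩ := exists_collectAt_length hout k
      exact ⟨j, by simp [Reg.size, G, hj]⟩
    refine ⟨hr, ?_⟩
    funext i
    have hi := padIndex_length (G φ) hr i
    -- The value at the padding index is an initial segment of `p` of length `i + 1`, so its last
    -- entry is `p i`.
    obtain ⟨k, t, e⟩ := collectAt_of_outputs hout (padIndex (G φ) i)
    have e' : (G φ) (zeros Sig (padIndex (G φ) i)) = (List.range k).map p := by simp [G, e]
    simp only [padding, paddingFun, e', List.getElem_map, List.getElem_range]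
  · intro φ ψ hψ u
    obtain rfl := Part.mem_some_iff.1 hψ
    exact (loop_collect_halts h1 u le_rfl).2
  -- This is `n · (10n + L(n) + 20)`, the bound of `loop_collect` with `|φ []|` replaced by the
  -- larger `|φ|(n)`.
  · refine ⟨.mul .var (.add (.add (.mul (.const 10) .var) (.app .var)) (.const 20)), fun φ u => ?_⟩
    have hle : (φ []).length ≤ φ.size u.length := φ.2 _ _ (by simp)
    refine (loop_collect_halts h1 u (Nat.mul_le_mul_left _ ?_)).1
    simp only [SOPoly.eval, PNat.val_ofNat]
    omega

theorem isComputableMap_of_isPolyTimeMap (h : IsPolyTimeMap δX (δY.comp (padding Sig)) f) :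
    IsComputableMap δX δY f := by
  obtain ⟨F, hF, M, hM, -⟩ := h
  obtain ⟨one, h1⟩ := exists_ne (0 : Sig)
  refine ⟨(padding Sig).toPFun.comp F, ?_, loop false one M, ?_⟩
  · intro φ x hx
    obtain ⟨ψ, hψ, hy⟩ := hF φ x hx
    obtain ⟨p, hp, hy⟩ := Part.mem_bind_iff.1 hy
    exact ⟨p, Part.mem_bind hψ hp, hy⟩
  · intro φ p hp i
    obtain ⟨ψ, hψ, hr, rfl⟩ := Part.mem_bind_iff.1 hp
    have hi := padIndex_length ψ hr i
    have h := loop_outputs_of_first_long (M := M) (φ := φ) h1 (zeros Sig i)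
      (v := fun n => ψ (zeros Sig n)) (m := padIndex ψ i) (fun n => hM φ ψ hψ _) (fun n hn => ?_)
      (by simp [hi])
    · simpa [padding, paddingFun] using h
    -- Before the padding index, monotonicity bounds the size by `i + 1` and minimality excludes `i
    -- + 1` itself.
    · by_contra hlt
      have hle : ψ.size n ≤ ψ.size (padIndex ψ i) := ψ.size_mono hn.le
      have hsz : ψ.size (padIndex ψ i) = i + 1 := hi
      have hne : n ∉ {j | ψ.size j = i + 1} := Nat.notMem_of_lt_sInf hn
      simp only [List.length_replicate, not_le] at hlt
      change i < ψ.size n at hlt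
      exact hne (show ψ.size n = i + 1 by omega)

end Main

end TypeTwo

theorem mainTheorem8 {Sig : Type} [Finite Sig] [Nontrivial Sig] [Zero Sig] {X Y : Type*}
    (δX : TypeTwo.Representation (TypeTwo.Reg Sig) X)
    (δY : TypeTwo.Representation (TypeTwo.Cantor Sig) Y) (f : X → Y) :
    TypeTwo.IsComputableMap δX δY f ↔
      TypeTwo.IsPolyTimeMap δX (δY.comp (TypeTwo.padding Sig)) f :=
  ⟨TypeTwo.isPolyTimeMap_of_isComputableMap, TypeTwo.isComputableMap_of_isPolyTimeMap⟩
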